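/- Let $q$ be a prime power and $v\ge 2$ an integer. For $1\le i\le v-1$ let $\mathcal{G}_q(v,i)$ be the set of all $i$-dimensional subspaces of $\mathbb{F}_q^v$. For two elements $\Lambda=(W_1,\dots,W_{v-1})$ and $\Lambda'=(W_1',\dots,W_{v-1}')$ of the Cartesian product $\mathcal{G}_q(v,1)\times\mathcal{G}_q(v,2)\times\dots\times\mathcal{G}_q(v,v-1)$ the Grassmann distance is $$\mathrm{d}_{\mathrm{G}}(\Lambda,\Lambda')=\sum_{i=1}^{v-1}\bigl(i-\dim(W_i\cap W_i')\bigr).$$ Let $A_q^c(v,d)$ be the maximum cardinality of a subset $\mathcal{C}$ of this Cartesian product such that $\mathrm{d}_{\mathrm{G}}(\Lambda,\Lambda')\ge d$ for all distinct $\Lambda,\Lambda'\in\mathcal{C}$, and let $A_q^f(v,d)$ be the maximum cardinality of such a subset $\mathcal{C}$ all of whose elements are full flags, i.e. satisfy $W_1<W_2<\dots<W_{v-1}$. **Proposition.** For each integer $k\ge 1$ we have $$A_q^c(2k,k^2)=q^k+1,$$ and for each integer $k\ge 2$ we have $$A_q^c(2k+1,k^2+k)=q^{k+1}+1.$$ Moreover,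 $A_q^c(2k,k^2)=A_q^f(2k,k^2)$ for each $k\ge 1$ and $A_q^c(2k+1,k^2+k)=A_q^f(2k+1,k^2+k)$ for each $k\ge 2$. -/

import Mathlib

namespace FlagCode

/-- The set of all `k`-dimensional subspaces of `F ^ v`. -/
abbrev Grassmannian (F : Type*) [Field F] (v k : ℕ) : Type _ :=
  {W : Submodule F (Fin v → F) // Module.finrank F W = k}

/-- The injection distance `max (dim U, dim W) - dim (U ∩ W)` of two subspaces of `F ^ v`.
The subtraction never truncates, since `U ∩ W` is contained in both `U` and `W`. -/
noncomputable def injDist {F : Type*} [Field F] {v : ℕ} (U W : Submodule F (Fin v → F)) : ℕ :=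
  max (Module.finrank F U) (Module.finrank F W) - Module.finrank F ↥(U ⊓ W)

/-- The elements `(W_1, …, W_{v-1})` of the Cartesian product of the Grassmannians of
`1`-, `2`-, …, `(v-1)`-dimensional subspaces of `F ^ v`; the entry with index `i : Fin (v - 1)`
is `W_{i+1}`. -/
abbrev CartesianWord (F : Type*) [Field F] (v : ℕ) : Type _ :=
  ∀ i : Fin (v - 1), Grassmannian F v (i + 1)

/-- The Grassmann distance: the sum of the injection distances of the entries. -/
noncomputable def grassmannDist {F : Type*} [Field F] {v : ℕ} (x y : CartesianWord F v) : ℕ :=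
  ∑ i, injDist (x i).1 (y i).1

/-- A word is a full flag if its entries form a chain `W_1 < W_2 < ⋯ < W_{v-1}`. (That
`0 < W_1` and `W_{v-1} < F ^ v` is then clear from the dimensions.) -/
def IsFullFlag {F : Type*} [Field F] {v : ℕ} (x : CartesianWord F v) : Prop :=
  StrictMono fun i => (x i).1

/-- The minimum Grassmann distance of the code `C` is at least `d` (the minimum distance of a code
with fewer than two elements is `∞`). -/
def MinDistGe {F : Type*} [Field F] {v : ℕ} (C : Finset (CartesianWord F v)) (d : ℕ) : Prop :=
  ∀ x ∈ C, ∀ y ∈ C, x ≠ y → d ≤ grassmannDist x y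

/-- The sizes of Cartesian-product codes with minimum Grassmann distance at least `d`. -/
def cartesianCodeSizes (F : Type*) [Field F] (v d : ℕ) : Set ℕ :=
  {n | ∃ C : Finset (CartesianWord F v), MinDistGe C d ∧ C.card = n}

/-- The sizes of full flag codes with minimum Grassmann distance at least `d`. -/
def fullFlagCodeSizes (F : Type*) [Field F] (v d : ℕ) : Set ℕ :=
  {n | ∃ C : Finset (CartesianWord F v), (∀ x ∈ C, IsFullFlag x) ∧ MinDistGe C d ∧ C.card = n}

/-- `A_q^c(v, d)`: the maximum size of a Cartesian-product code with minimum Grassmann distance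
at least `d`. -/
noncomputable def maxCartesianCode (F : Type*) [Field F] (v d : ℕ) : ℕ :=
  sSup (cartesianCodeSizes F v d)

/-- `A_q^f(v, d)`: the maximum size of a full flag code with minimum Grassmann distance
at least `d`. -/
noncomputable def maxFullFlagCode (F : Type*) [Field F] (v d : ℕ) : ℕ :=
  sSup (fullFlagCodeSizes F v d)

theorem bddAbove_cartesianCodeSizes (F : Type*) [Field F] [Finite F] (v d : ℕ) :
    BddAbove (cartesianCodeSizes F v d) := by
  have : Finite (Submodule F (Fin v → F)) := Finite.of_injective _ SetLike.coe_injective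
  have := Fintype.ofFinite (CartesianWord F v)
  refine ⟨Fintype.card (CartesianWord F v), ?_⟩
  rintro n ⟨C, -, rfl⟩
  exact C.card_le_univ

/-- Over a finite field the supremum defining `A_q^c(v, d)` is a maximum. -/
theorem isGreatest_maxCartesianCode (F : Type*) [Field F] [Finite F] (v d : ℕ) :
    IsGreatest (cartesianCodeSizes F v d) (maxCartesianCode F v d) := by
  have hb := bddAbove_cartesianCodeSizes F v d
  exact ⟨Nat.sSup_mem ⟨0, ∅, by simp [MinDistGe], rfl⟩ hb, fun n hn => le_csSup hb hn⟩

/-- Over a finite field the supremum defining `A_q^f(v, d)` is a maximum. -/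
theorem isGreatest_maxFullFlagCode (F : Type*) [Field F] [Finite F] (v d : ℕ) :
    IsGreatest (fullFlagCodeSizes F v d) (maxFullFlagCode F v d) := by
  have hb : BddAbove (fullFlagCodeSizes F v d) := by
    refine (bddAbove_cartesianCodeSizes F v d).mono ?_
    rintro n ⟨C, _, hC, hn⟩
    exact ⟨C, hC, hn⟩
  exact ⟨Nat.sSup_mem ⟨0, ∅, by simp, by simp [MinDistGe], rfl⟩ hb, fun n hn => le_csSup hb hn⟩

end FlagCode

/-! Write v = k + m with m = k or m = k + 1. Two n-dimensional subspaces have distance at most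
min(n, v - n), and these bounds sum to km (`sum_min_eq_mul`), the required minimum distance. Hence
every entry attains its bound, and the k-dimensional entries of the codewords form a partial spread.

For m = k, counting nonzero vectors bounds its size. For m = k + 1, the argument is by holes, the
nonzero vectors left uncovered. With q^(k+1) + 2 members, congruences modulo q^(k-1) and q - 1 force
many holes in every hyperplane (`card_holes_hyperplane`); averaging over hyperplanes contradicts the
total number of holes.

For the lower bound, `exists_partialSpread_pair` uses multiplication in the extension field L of
degree m to build pairs P ≤ X. The P's are pairwise disjoint, dim X ≤ k + 1, and any two X's span
everything. A full flag through P, and through a (k+1)-space containing X, has disjoint entries up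
to dimension k and spanning entries from k + 1 on, so every bound is attained. -/

namespace FlagCode

open Finset Module

/-! ### Upper bounds for partial spreads -/

section PartialSpread

variable {F V ι : Type*} [Field F] [Fintype F] [AddCommGroup V] [Module F V] [Fintype V]

open Classical in
/-- The nonzero vectors contained in none of the subspaces `P i` with `i ∈ S`. -/
noncomputable def holes (S : Finset ι) (P : ι → Submodule F V) : Finset V :=
  univ.filter fun x => x ≠ 0 ∧ ∀ i ∈ S, x ∉ P i

open Classical in
/-- Counting the vectors of `U` by the member of a partial spread containing them. -/
theorem card_add_card_eq_holes (S : Finset ι) (P : ι → Submodule F V)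
    (hP : ∀ i ∈ S, ∀ j ∈ S, i ≠ j → Disjoint (P i) (P j)) (U : Submodule F V) :
    Fintype.card F ^ finrank F U + #S =
      #{x ∈ holes S P | x ∈ U} + 1 +
        ∑ i ∈ S, Fintype.card F ^ finrank F ↥(P i ⊓ U) := by
  have hcard (W : Submodule F V) : Fintype.card F ^ finrank F W = #{x : V | x ∈ W ∧ x ≠ 0} + 1 := by
    have h : ({x : V | x ∈ W ∧ x ≠ 0} : Finset V) = ({x : V | x ∈ W} : Finset V).erase 0 := by
      ext x; simp [and_comm]
    rw [h, card_erase_add_one (by simp), ← Module.card_eq_pow_finrank, Fintype.card_subtype]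
  have hU : ({x : V | x ∈ U ∧ x ≠ 0} : Finset V) =
      {x ∈ holes S P | x ∈ U} ∪ S.biUnion fun i => {x : V | x ∈ P i ⊓ U ∧ x ≠ 0} := by
    ext x
    simp only [holes, mem_filter, mem_univ, true_and, mem_union, mem_biUnion, Submodule.mem_inf]
    grind
  have hd : Disjoint ({x ∈ holes S P | x ∈ U})
      (S.biUnion fun i => ({x : V | x ∈ P i ⊓ U ∧ x ≠ 0} : Finset V)) := by
    rw [Finset.disjoint_left]
    intro x
    simp only [holes, mem_filter, mem_univ, true_and, mem_biUnion, Submodule.mem_inf]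
    grind
  have hb : ∀ i ∈ S, ∀ j ∈ S, i ≠ j →
      Disjoint ({x : V | x ∈ P i ⊓ U ∧ x ≠ 0} : Finset V)
        ({x : V | x ∈ P j ⊓ U ∧ x ≠ 0} : Finset V) := by
    intro i hi j hj hij
    rw [Finset.disjoint_left]
    intro x
    simp only [mem_filter, mem_univ, true_and, Submodule.mem_inf]
    rintro ⟨⟨hxi, -⟩, hx0⟩ ⟨⟨hxj, -⟩, -⟩
    exact hx0 (Submodule.disjoint_def.mp (hP i hi j hj hij) x hxi hxj)
  simp only [hcard]
  rw [hU, card_union_of_disjoint hd, card_biUnion hb, sum_add_distrib]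
  simp only [sum_const, smul_eq_mul, mul_one]
  ring

/-- A partial `k`-spread of a `2k`-dimensional space has at most `q ^ k + 1` elements. -/
theorem card_partialSpread_even_le (S : Finset ι) (P : ι → Submodule F V) {k : ℕ} (hk : 1 ≤ k)
    (hV : finrank F V = 2 * k) (hdim : ∀ i ∈ S, finrank F (P i) = k)
    (hP : ∀ i ∈ S, ∀ j ∈ S, i ≠ j → Disjoint (P i) (P j)) :
    #S ≤ Fintype.card F ^ k + 1 := by
  classical
  have h := card_add_card_eq_holes S P hP ⊤
  have hq : 1 < Fintype.card F ^ k := Nat.one_lt_pow (by omega) Fintype.one_lt_card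
  rw [finrank_top, hV, sum_congr rfl fun i hi => by rw [inf_top_eq, hdim i hi]] at h
  rw [sum_const, smul_eq_mul, two_mul, pow_add] at h
  generalize Fintype.card F ^ k = Q at *
  nlinarith

open Classical in
/-- A partial `k`-spread of size `q ^ (k + 1) + 2` of a `(2k + 1)`-dimensional space has at least
`1 + q ^ (k - 1) (q - 2)` holes in each hyperplane. -/
theorem card_holes_hyperplane (S : Finset ι) (P : ι → Submodule F V) {k : ℕ}
    (hk : 1 ≤ k) (hdim : ∀ i ∈ S, finrank F (P i) = k + 1)
    (hP : ∀ i ∈ S, ∀ j ∈ S, i ≠ j → Disjoint (P i) (P j))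
    (hS : #S = Fintype.card F ^ (k + 2) + 2) (U : Submodule F V)
    (hV : finrank F V = 2 * k + 3) (hU : finrank F U = 2 * k + 2) :
    (1 + Fintype.card F ^ k * (Fintype.card F - 2) : ℤ) ≤ #{x ∈ holes S P | x ∈ U} := by
  classical
  have h := card_add_card_eq_holes S P hP U
  have hq : 2 ≤ Fintype.card F := Fintype.one_lt_card
  have hqk : 2 ≤ Fintype.card F ^ k := hq.trans (Nat.le_self_pow (by omega) _)
  have hinf : ∀ i ∈ S, finrank F ↥(P i ⊓ U) = k ∨ finrank F ↥(P i ⊓ U) = k + 1 := by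
    intro i hi
    have h1 := Submodule.finrank_sup_add_finrank_inf_eq (P i) U
    have h2 := Submodule.finrank_le (P i ⊔ U)
    have h3 := Submodule.finrank_mono (R := F) (inf_le_left : P i ⊓ U ≤ P i)
    have := hdim i hi
    omega
  zify at h hS hq hqk ⊢
  rw [hU, hS] at h
  generalize ((Fintype.card F : ℕ) : ℤ) = q at *
  have hone (n : ℕ) : q - 1 ∣ q ^ n - 1 := sub_one_dvd_pow_sub_one q n
  obtain ⟨c, hc⟩ : q ^ k ∣ ∑ i ∈ S, q ^ finrank F ↥(P i ⊓ U) :=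
    dvd_sum fun i hi => pow_dvd_pow q (by rcases hinf i hi with h | h <;> omega)
  obtain ⟨e, he⟩ : q - 1 ∣ ∑ i ∈ S, (q ^ finrank F ↥(P i ⊓ U) - 1) :=
    dvd_sum fun i hi => hone _
  rw [sum_sub_distrib, sum_const, nsmul_one, hS] at he
  have hcard : (0 : ℤ) ≤ #{x ∈ holes S P | x ∈ U} := by positivity
  generalize (#{x ∈ holes S P | x ∈ U} : ℤ) = m at *
  generalize (∑ i ∈ S, q ^ finrank F ↥(P i ⊓ U)) = s at *
  -- Every member meets `U` in dimension k or k + 1, so q^k divides `s` and m ≡ 1 modulo q^k.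
  obtain ⟨t, ht⟩ : ∃ t, m = 1 + q ^ k * t := ⟨q ^ (k + 2) + q ^ 2 - c, by
    rw [hc] at h; linear_combination -h⟩
  -- t ≤ -1 would give m ≤ 1 - q^k < 0; this needs q^k ≥ 2, hence k ≥ 1.
  have ht0 : 0 ≤ t := by
    by_contra! hlt
    nlinarith
  obtain ⟨a, ha⟩ := hone k
  obtain ⟨b, hb⟩ := hone (2 * k + 2)
  -- Nonzero vectors of a subspace come in multiples of q - 1, so q - 1 divides m, while m ≡ 1 + t
  -- modulo q - 1. With t ≥ 0 this yields t ≥ q - 2.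
  have hdvd : q - 1 ∣ t + 1 := ⟨b - e - a * t, by
    have : m = (q - 1) * (b - e) := by linear_combination hb - he - h
    linear_combination this - ht - t * ha⟩
  have := Int.le_of_dvd (by omega) hdvd
  rw [ht]
  have : q ^ k * (q - 2) ≤ q ^ k * t := by
    apply mul_le_mul_of_nonneg_left <;> omega
  omega

omit [Fintype V] in
-- Evaluation at x is a nonzero functional on the dual space, so its kernel is a hyperplane there.
theorem card_dual_vanishing {n : ℕ} [Fintype (Dual F V)] [DecidableEq (Dual F V)] [DecidableEq F]
    (hV : finrank F V = n + 1) {x : V} (hx : x ≠ 0) :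
    #{φ : Dual F V | φ ≠ 0 ∧ φ x = 0} + 1 = Fintype.card F ^ n := by
  classical
  have : FiniteDimensional F V := .of_finrank_pos (by omega)
  have hne : Dual.eval F V x ≠ 0 := by
    rwa [Ne, Module.eval_apply_eq_zero_iff]
  have h := Dual.finrank_ker_add_one_of_ne_zero hne
  rw [Subspace.dual_finrank_eq, hV, Nat.add_right_cancel_iff] at h
  have he : ({φ : Dual F V | φ ≠ 0 ∧ φ x = 0} : Finset _) =
      ({φ : Dual F V | φ ∈ LinearMap.ker (Dual.eval F V x)} : Finset _).erase 0 := by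
    ext φ; simp
  rw [he, card_erase_add_one (by simp), ← h,
    ← Module.card_eq_pow_finrank (V := LinearMap.ker (Dual.eval F V x)), Fintype.card_subtype]

/-- A partial `k`-spread of a `(2k + 1)`-dimensional space, `k ≥ 2`, has at most
`q ^ (k + 1) + 1` elements. -/
theorem card_partialSpread_odd_le (S : Finset ι) (P : ι → Submodule F V) {k : ℕ} (hk : 2 ≤ k)
    (hV : finrank F V = 2 * k + 1) (hdim : ∀ i ∈ S, finrank F (P i) = k)
    (hP : ∀ i ∈ S, ∀ j ∈ S, i ≠ j → Disjoint (P i) (P j)) :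
    #S ≤ Fintype.card F ^ (k + 1) + 1 := by
  classical
  by_contra! hlt
  -- Exactly q^(k+1) + 2 members are kept, so that the number of holes is known exactly.
  obtain ⟨T, hTS, hT⟩ := exists_subset_card_eq (show Fintype.card F ^ (k + 1) + 2 ≤ #S from hlt)
  replace hdim : ∀ i ∈ T, finrank F (P i) = k := fun i hi => hdim i (hTS hi)
  replace hP : ∀ i ∈ T, ∀ j ∈ T, i ≠ j → Disjoint (P i) (P j) :=
    fun i hi j hj => hP i (hTS hi) j (hTS hj)
  obtain ⟨k, rfl⟩ : ∃ l, k = l + 1 := ⟨k - 1, by omega⟩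
  have : FiniteDimensional F V := .of_finrank_pos (by omega)
  have : Finite (Dual F V) := Module.finite_of_finite F
  have := Fintype.ofFinite (Dual F V)
  have hq : 2 ≤ Fintype.card F := Fintype.one_lt_card
  have htop := card_add_card_eq_holes T P hP ⊤
  rw [finrank_top, hV, sum_congr rfl fun i hi => by rw [inf_top_eq, hdim i hi], hT] at htop
  simp only [sum_const, smul_eq_mul, Submodule.mem_top, filter_true, hT] at htop
  have hhyp : ∀ φ ∈ ({φ : Dual F V | φ ≠ 0} : Finset (Dual F V)),
      (1 + Fintype.card F ^ k * (Fintype.card F - 2) : ℤ) ≤ #{x ∈ holes T P | φ x = 0} := by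
    intro φ hφ
    have h := Dual.finrank_ker_add_one_of_ne_zero (by simpa using hφ : φ ≠ 0)
    have := card_holes_hyperplane T P (by omega) hdim hP hT (LinearMap.ker φ) (by omega) (by omega)
    simpa using this
  have hsum := sum_le_sum hhyp
  have hdual : #{φ : Dual F V | φ ≠ 0} + 1 = Fintype.card F ^ (2 * k + 3) := by
    have h : ({φ : Dual F V | φ ≠ 0} : Finset _) = univ.erase 0 := by ext; simp
    rw [h, card_erase_add_one (mem_univ _), card_univ, Module.card_eq_pow_finrank (K := F),
      Subspace.dual_finrank_eq, hV]
    congr 1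
  -- Double count of pairs (φ, x) with φ x = 0. Functionals replace hyperplanes; each hyperplane is
  -- counted q - 1 times.
  have hdc : ∑ φ : Dual F V with φ ≠ 0, #{x ∈ holes T P | φ x = 0} =
      ∑ x ∈ holes T P, #{φ : Dual F V | φ ≠ 0 ∧ φ x = 0} := by
    have := sum_card_bipartiteAbove_eq_sum_card_bipartiteBelow
      (s := ({φ : Dual F V | φ ≠ 0} : Finset _)) (t := holes T P) (fun φ x => φ x = 0)
    simpa [bipartiteAbove, bipartiteBelow, filter_filter] using this
  have hx : ∀ x ∈ holes T P, (#{φ : Dual F V | φ ≠ 0 ∧ φ x = 0} : ℤ) =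
      (Fintype.card F : ℤ) ^ (2 * k + 2) - 1 := by
    intro x hx
    have h := card_dual_vanishing (F := F) (n := 2 * k + 2) (by omega)
      (x := x) (by simp [holes] at hx; exact hx.1)
    zify at h
    linarith
  zify at hdc htop hdual hq
  rw [hdc, sum_congr rfl hx, sum_const, sum_const, nsmul_eq_mul, nsmul_eq_mul,
    eq_sub_of_add_eq hdual] at hsum
  generalize (#(holes T P) : ℤ) = m at *
  have hm : m = 1 + (Fintype.card F : ℤ) ^ (k + 1) * (Fintype.card F - 2) := by
    linear_combination -htop
  rw [hm] at hsum
  generalize (Fintype.card F : ℤ) = q at *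
  have hQ : 1 ≤ q ^ k := one_le_pow₀ (by omega)
  have e1 : q ^ (2 * k + 3) = (q ^ k) ^ 2 * q ^ 3 := by ring
  have e2 : q ^ (2 * k + 2) = (q ^ k) ^ 2 * q ^ 2 := by ring
  have e3 : q ^ (k + 1) = q ^ k * q := by ring
  rw [e1, e2, e3] at hsum
  generalize q ^ k = Q at *
  -- The left side of `hsum` exceeds the right side by exactly the sum of the terms in `h1` and
  -- `h2`.
  have h1 : 0 < Q ^ 2 * q ^ 2 * (q - 1) := by
    have : 0 < q - 1 := by omega
    positivity
  have h2 : 0 ≤ Q * (q - 1) * (q - 2) := by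
    have : 0 ≤ q - 1 := by omega
    have : 0 ≤ q - 2 := by omega
    positivity
  nlinarith

end PartialSpread

/-! ### Extending subspaces to complete flags -/

section Chains

variable {F V : Type*} [Field F] [AddCommGroup V] [Module F V] [FiniteDimensional F V]

theorem exists_le_finrank_eq_add_one {P Q : Submodule F V} (h : P < Q) :
    ∃ P', P ≤ P' ∧ P' ≤ Q ∧ finrank F P' = finrank F P + 1 := by
  obtain ⟨x, hxQ, hxP⟩ := SetLike.exists_of_lt h
  exact ⟨P ⊔ Submodule.span F {x}, le_sup_left,
    sup_le h.le ((Submodule.span_singleton_le_iff_mem x Q).mpr hxQ),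
    Submodule.finrank_sup_span_singleton hxP⟩

/-- Any interval of subspaces contains a chain going up one dimension at a time. -/
theorem exists_chain {P Q : Submodule F V} (h : P ≤ Q) :
    ∃ f : ℕ → Submodule F V, Monotone f ∧ (∀ i, P ≤ f i ∧ f i ≤ Q) ∧
      ∀ i, finrank F P + i ≤ finrank F Q → finrank F (f i) = finrank F P + i := by
  classical
  have hstep : ∀ R : Set.Icc P Q, ∃ R' : Set.Icc P Q, R ≤ R' ∧
      (finrank F R.1 < finrank F Q → finrank F R'.1 = finrank F R.1 + 1) := by
    rintro ⟨R, hPR, hRQ⟩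
    rcases hRQ.eq_or_lt with rfl | hlt
    · exact ⟨⟨R, hPR, le_rfl⟩, le_rfl, fun h => absurd h (lt_irrefl _)⟩
    · obtain ⟨R', h1, h2, h3⟩ := exists_le_finrank_eq_add_one hlt
      exact ⟨⟨R', hPR.trans h1, h2⟩, h1, fun _ => h3⟩
  choose up hle hup using hstep
  -- Iterating inside the interval keeps the chain between `P` and `Q` even after it has reached
  -- `Q`.
  let g : ℕ → Set.Icc P Q := fun i => up^[i] ⟨P, le_rfl, h⟩
  have hg (i : ℕ) : g (i + 1) = up (g i) := Function.iterate_succ_apply' _ _ _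
  refine ⟨fun i => (g i).1, monotone_nat_of_le_succ fun i => ?_, fun i => (g i).2, fun i => ?_⟩
  · rw [hg]; exact hle _
  · induction i with
    | zero => exact fun _ => rfl
    | succ i ih =>
      intro hi
      have h1 : finrank F (g i).1 = finrank F P + i := ih (by omega)
      have h2 := congrArg (fun R : Set.Icc P Q => finrank F R.1) (hg i)
      exact h2.trans (by rw [hup _ (by omega), h1, add_assoc])

/-- Subspaces `P ≤ Q` of consecutive dimensions belong to a complete flag. -/
theorem exists_completeFlag {P Q : Submodule F V} {k : ℕ} (h : P ≤ Q) (hP : finrank F P = k)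
    (hQ : finrank F Q = k + 1) :
    ∃ f : ℕ → Submodule F V, Monotone f ∧ f k = P ∧ f (k + 1) = Q ∧
      ∀ i ≤ finrank F V, finrank F (f i) = i := by
  obtain ⟨a, ha, haP, had⟩ := exists_chain (bot_le : ⊥ ≤ P)
  obtain ⟨b, hb, hbQ, hbd⟩ := exists_chain (le_top : Q ≤ ⊤)
  simp only [finrank_bot, zero_add, finrank_top] at had hbd
  have hak : a k = P := Submodule.eq_of_le_of_finrank_eq (haP k).2 (by rw [had k (by omega), hP])
  have hb0 : b 0 = Q := by
    have := Submodule.finrank_le Q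
    exact (Submodule.eq_of_le_of_finrank_eq (hbQ 0).1 (by rw [hbd 0 (by omega), add_zero])).symm
  refine ⟨fun i => if i ≤ k then a i else b (i - (k + 1)), ?_, ?_, ?_, ?_⟩
  · intro i j hij
    dsimp only
    split_ifs with h1 h2 h2
    · exact ha hij
    · exact (haP i).2.trans (h.trans (hbQ _).1)
    · omega
    · exact hb (by omega)
  · simpa using hak
  · simpa using hb0
  · intro i hi
    by_cases h1 : i ≤ k
    · exact (congrArg (fun R : Submodule F V => finrank F R) (if_pos h1)).trans (had i (by omega))
    · refine (congrArg (fun R : Submodule F V => finrank F R) (if_neg h1)).trans ?_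
      rw [hbd _ (by omega)]
      omega

theorem exists_ge_finrank_eq {P : Submodule F V} {n : ℕ} (h : finrank F P ≤ n)
    (hn : n ≤ finrank F V) : ∃ Q, P ≤ Q ∧ finrank F Q = n := by
  obtain ⟨f, -, hf, hd⟩ := exists_chain (le_top : P ≤ ⊤)
  refine ⟨f (n - finrank F P), (hf _).1, ?_⟩
  rw [hd _ (by rw [finrank_top]; omega)]
  omega

end Chains

/-! ### Construction of the spread pairs from an extension field -/

section Spread

/-- Over a finite field there are `q ^ m + 1` pairwise disjoint `k`-dimensional subspaces of a
`(k + m)`-dimensional space, `m ∈ {k, k + 1}`, contained in subspaces of dimension at most `k + 1`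
any two of which span the whole space. -/
theorem exists_partialSpread_pair (F : Type*) [Field F] [Fintype F] {k m : ℕ} (hk : 1 ≤ k)
    (hm : m = k ∨ m = k + 1) :
    ∃ (ι : Type) (_ : Fintype ι) (P X : ι → Submodule F (Fin (k + m) → F)),
      Fintype.card ι = Fintype.card F ^ m + 1 ∧ (∀ a, finrank F (P a) = k) ∧
      (∀ a, P a ≤ X a) ∧ (∀ a, finrank F (X a) ≤ k + 1) ∧
      (∀ a b, a ≠ b → Disjoint (P a) (P b)) ∧ ∀ a b, a ≠ b → X a ⊔ X b = ⊤ := by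
  classical
  obtain ⟨p, hp⟩ := CharP.exists F
  have : Fact p.Prime := ⟨CharP.char_is_prime F p⟩
  have : NeZero m := ⟨by omega⟩
  let L := FiniteField.Extension F p m
  have hL : finrank F L = m := FiniteField.finrank_extension F p m
  have : Fintype L := Fintype.ofFinite L
  -- A is L itself if m = k, and a complement of the line F·1 if m = k + 1.
  obtain ⟨A, hA, hAtop⟩ : ∃ A : Submodule F L, finrank F A = k ∧ A ⊔ Submodule.span F {1} = ⊤ := by
    rcases hm with rfl | rfl
    · exact ⟨⊤, by rw [finrank_top, hL], top_sup_eq _⟩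
    · obtain ⟨A, hA⟩ := (Submodule.span F {(1 : L)}).exists_isCompl
      have := Submodule.finrank_add_eq_of_isCompl hA
      rw [finrank_span_singleton one_ne_zero, hL] at this
      exact ⟨A, by omega, hA.symm.sup_eq_top⟩
  let e : (A × L) ≃ₗ[F] (Fin (k + m) → F) := LinearEquiv.ofFinrankEq _ _ (by simp [hA, hL])
  obtain ⟨B, -, hB⟩ := exists_ge_finrank_eq (P := (⊥ : Submodule F L)) (n := k) (by simp) (by omega)
  let g (a : L) : A →ₗ[F] A × L := LinearMap.prod LinearMap.id (LinearMap.mulLeft F a ∘ₗ A.subtype)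
  have hg (a : L) (x : A) : g a x = (x, a * x) := rfl
  have hginj (a : L) : Function.Injective (g a) := fun x y h => congrArg Prod.fst h
  -- `P` consists of the graphs of x ↦ ax on A and one subspace of 0 × L. For m = k + 1, `X (some
  -- a)` is the graph of z ↦ az on all of L, projected to A × L along F·1 in the first coordinate: z
  -- = x + c goes to (x, ax + ca).
  let P : Option L → Submodule F (A × L) := fun o =>
    o.elim (B.map (LinearMap.inr F A L)) fun a => LinearMap.range (g a)
  let X : Option L → Submodule F (A × L) := fun o =>
    o.elim (LinearMap.range (LinearMap.inr F A L)) fun a =>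
      LinearMap.range (g a) ⊔ Submodule.span F {(0, a)}
  have hPd : ∀ o, finrank F (P o) = k := by
    rintro (_ | a)
    · exact (Submodule.equivMapOfInjective _ LinearMap.inr_injective B).finrank_eq.symm.trans hB
    · exact (LinearMap.finrank_range_of_inj (hginj a)).trans hA
  have hPX : ∀ o, P o ≤ X o := by
    rintro (_ | a)
    · exact LinearMap.map_le_range
    · exact le_sup_left
  have hXd : ∀ o, finrank F (X o) ≤ k + 1 := by
    rintro (_ | a)
    · have := LinearMap.finrank_range_of_inj (LinearMap.inr_injective (R := F) (M := A) (M₂ := L))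
      change finrank F (LinearMap.range (LinearMap.inr F A L)) ≤ k + 1
      omega
    · refine (Submodule.finrank_add_le_finrank_add_finrank _ _).trans ?_
      rw [LinearMap.finrank_range_of_inj (hginj a), hA]
      have := finrank_span_le_card (R := F) ({(0, a)} : Set (A × L))
      simp at this
      omega
  have hdis0 (a : L) : Disjoint (P none) (P (some a)) := by
    rw [Submodule.disjoint_def]
    rintro _ ⟨b, -, rfl⟩ ⟨x, hx⟩
    rw [hg, LinearMap.inr_apply, Prod.mk.injEq] at hx
    rw [LinearMap.inr_apply, ← hx.2, hx.1]
    simp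
  have hdis : ∀ o o', o ≠ o' → Disjoint (P o) (P o') := by
    rintro (_ | a) (_ | b) hab
    · exact absurd rfl hab
    · exact hdis0 b
    · exact (hdis0 a).symm
    · rw [Submodule.disjoint_def]
      rintro _ ⟨x, rfl⟩ ⟨y, hy⟩
      rw [hg, hg, Prod.mk.injEq] at hy
      obtain ⟨rfl, hy⟩ := hy
      have : (b - a) * (y : L) = 0 := by rw [sub_mul, hy, sub_self]
      rcases mul_eq_zero.mp this with h | h
      · exact absurd (congrArg some (sub_eq_zero.mp h).symm) hab
      · rw [show y = 0 from Subtype.ext h, map_zero]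
  have hsup (a : L) (U : Submodule F (A × L)) (hU : LinearMap.range (g a) ≤ U)
      (hinr : ∀ z : L, ((0, z) : A × L) ∈ U) : U = ⊤ := by
    rw [eq_top_iff]
    rintro ⟨x, y⟩ -
    have := U.add_mem (hU ⟨x, rfl⟩) (hinr (y - a * x))
    simpa [hg] using this
  have htop0 (a : L) : X none ⊔ X (some a) = ⊤ :=
    hsup a _ (le_sup_left.trans le_sup_right) fun z => Submodule.mem_sup_left ⟨z, rfl⟩
  have htop : ∀ o o', o ≠ o' → X o ⊔ X o' = ⊤ := by
    rintro (_ | a) (_ | b) hab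
    · exact absurd rfl hab
    · exact htop0 b
    · rw [sup_comm]; exact htop0 a
    · have hab' : a - b ≠ 0 := sub_ne_zero.mpr fun h => hab (congrArg some h)
      refine hsup a _ (le_sup_left.trans le_sup_left) fun z => ?_
      -- Write (a - b)⁻¹z = x + c with x in A and c in F. The vectors (x, ax + ca) and (x, bx + cb)
      -- then differ by (0, z).
      obtain ⟨x, hx, y, hy, hxy⟩ := Submodule.mem_sup.mp
        (hAtop ▸ Submodule.mem_top : (a - b)⁻¹ * z ∈ A ⊔ Submodule.span F {(1 : L)})
      obtain ⟨c, rfl⟩ := Submodule.mem_span_singleton.mp hy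
      have h1 : ((⟨x, hx⟩, a * x) : A × L) + c • (0, a) ∈ X (some a) :=
        Submodule.add_mem_sup ⟨⟨x, hx⟩, rfl⟩
          (Submodule.smul_mem _ _ (Submodule.mem_span_singleton_self _))
      have h2 : ((⟨x, hx⟩, b * x) : A × L) + c • (0, b) ∈ X (some b) :=
        Submodule.add_mem_sup ⟨⟨x, hx⟩, rfl⟩
          (Submodule.smul_mem _ _ (Submodule.mem_span_singleton_self _))
      have h3 := Submodule.sub_mem _ (Submodule.mem_sup_left (T := X (some b)) h1)
        (Submodule.mem_sup_right (S := X (some a)) h2)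
      convert h3 using 1
      have hz : z = (a - b) * (x + c • 1) := by rw [hxy, mul_inv_cancel_left₀ hab']
      ext
      · simp
      · simp only [hz, Prod.snd_sub, Prod.snd_add, Prod.smul_snd, Algebra.smul_def]
        ring
  have hcard : Fintype.card L = Fintype.card F ^ m := by
    rw [Module.card_eq_pow_finrank (K := F), hL]
  let E := (Fintype.equivFin (Option L)).symm
  refine ⟨Fin (Fintype.card (Option L)), inferInstance, fun i => (P (E i)).map e.toLinearMap,
    fun i => (X (E i)).map e.toLinearMap, ?_, fun i => ?_, fun i => ?_, fun i => ?_,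
    fun i j hij => ?_, fun i j hij => ?_⟩
  · rw [Fintype.card_fin, Fintype.card_option, hcard]
  · exact (LinearEquiv.finrank_map_eq e _).trans (hPd _)
  · exact Submodule.map_mono (hPX _)
  · exact (LinearEquiv.finrank_map_eq e _).trans_le (hXd _)
  · exact (Submodule.disjoint_map e.injective (hdis _ _ fun h => hij (E.injective h)))
  · rw [← Submodule.map_sup, htop _ _ fun h => hij (E.injective h), Submodule.map_top,
      LinearEquiv.range]

end Spread

/-! ### Bounds on the distance -/

section Distance

variable {F : Type*} [Field F] {v : ℕ}

theorem injDist_add_finrank_inf {U W : Submodule F (Fin v → F)} {n : ℕ} (hU : finrank F U = n)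
    (hW : finrank F W = n) : injDist U W + finrank F ↥(U ⊓ W) = n := by
  have := Submodule.finrank_mono (R := F) (inf_le_left : U ⊓ W ≤ U)
  rw [injDist, hU, hW, max_self]
  omega

theorem injDist_add_eq_finrank_sup {U W : Submodule F (Fin v → F)} {n : ℕ} (hU : finrank F U = n)
    (hW : finrank F W = n) : injDist U W + n = finrank F ↥(U ⊔ W) := by
  have h1 := injDist_add_finrank_inf hU hW
  have h2 := Submodule.finrank_sup_add_finrank_inf_eq U W
  omega

theorem injDist_le_min {U W : Submodule F (Fin v → F)} {n : ℕ} (hU : finrank F U = n)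
    (hW : finrank F W = n) : injDist U W ≤ min n (v - n) := by
  have h1 := injDist_add_finrank_inf hU hW
  have h2 := injDist_add_eq_finrank_sup hU hW
  have h3 := Submodule.finrank_le (U ⊔ W)
  rw [finrank_fin_fun] at h3
  omega

/-- The minima run up from 1 to k and then down from m - 1 to 1, giving two triangular numbers with
sum km. -/
theorem sum_min_eq_mul {k m : ℕ} (hk : 1 ≤ k) (hm : m = k ∨ m = k + 1) :
    ∑ i : Fin (k + m - 1), min ((i : ℕ) + 1) (k + m - (i + 1)) = k * m := by
  rw [Fin.sum_univ_eq_sum_range fun i => min (i + 1) (k + m - (i + 1)),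
    show k + m - 1 = k + (m - 1) by omega, sum_range_add]
  have h1 : ∑ i ∈ range k, min (i + 1) (k + m - (i + 1)) = ∑ i ∈ range k, (i + 1) :=
    sum_congr rfl fun i hi => by rw [mem_range] at hi; omega
  have h2 : ∑ i ∈ range (m - 1), min (k + i + 1) (k + m - (k + i + 1)) =
      ∑ i ∈ range (m - 1), (i + 1) := by
    rw [← sum_range_reflect fun i => i + 1]
    exact sum_congr rfl fun i hi => by rw [mem_range] at hi; omega
  have gauss (n : ℕ) : 2 * ∑ i ∈ range n, (i + 1) = n * (n + 1) := by
    induction n with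
    | zero => rfl
    | succ n ih => rw [sum_range_succ, mul_add, ih]; ring
  rw [h1, h2]
  have g1 := gauss k
  have g2 := gauss (m - 1)
  rcases hm with rfl | rfl
  · obtain ⟨k, rfl⟩ : ∃ l, m = l + 1 := ⟨m - 1, by omega⟩
    simp only [Nat.add_sub_cancel] at *
    nlinarith
  · simp only [Nat.add_sub_cancel] at *
    nlinarith

end Distance

/-! ### From partial spreads to codes and back -/

variable {F : Type*} [Field F] {k m : ℕ}

/-- In a code of maximum possible minimum distance the `k`-dimensional entries of different words
are disjoint. -/
theorem MinDistGe.disjoint (hk : 1 ≤ k) (hm : m = k ∨ m = k + 1)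
    {C : Finset (CartesianWord F (k + m))} (hC : MinDistGe C (k * m))
    (i : Fin (k + m - 1)) (hi : (i : ℕ) + 1 = k) :
    ∀ x ∈ C, ∀ y ∈ C, x ≠ y → Disjoint (x i).1 (y i).1 := by
  intro x hx y hy hxy
  have hle : ∀ j ∈ (univ : Finset (Fin (k + m - 1))),
      injDist (x j).1 (y j).1 ≤ min ((j : ℕ) + 1) (k + m - (j + 1)) :=
    fun j _ => injDist_le_min (x j).2 (y j).2
  have hsum := (sum_le_sum hle).antisymm ((sum_min_eq_mul hk hm).trans_le (hC x hx y hy hxy))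
  have h1 := (sum_eq_sum_iff_of_le hle).mp hsum i (mem_univ i)
  have h2 := injDist_add_finrank_inf (x i).2 (y i).2
  rw [disjoint_iff, ← Submodule.finrank_eq_zero (R := F)]
  omega

theorem mem_fullFlagCodeSizes [Fintype F] (hk : 1 ≤ k) (hm : m = k ∨ m = k + 1) :
    Fintype.card F ^ m + 1 ∈ fullFlagCodeSizes F (k + m) (k * m) := by
  classical
  obtain ⟨ι, _, P, X, hcard, hP, hPX, hX, hdis, htop⟩ := exists_partialSpread_pair F hk hm
  have hv : finrank F (Fin (k + m) → F) = k + m := finrank_fin_fun F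
  choose Q hXQ hQ using fun a => exists_ge_finrank_eq (hX a) (by omega)
  choose f hf hfk hfk1 hfd using fun a =>
    exists_completeFlag ((hPX a).trans (hXQ a)) (hP a) (hQ a)
  let w (a : ι) : CartesianWord F (k + m) := fun i => ⟨f a (i + 1), hfd a _ (by omega)⟩
  have hle {a b : ι} (hab : a ≠ b) (i : Fin (k + m - 1)) :
      min ((i : ℕ) + 1) (k + m - (i + 1)) ≤ injDist (w a i).1 (w b i).1 := by
    -- The entry at index i has dimension i + 1, so i < k is the range of entries inside `P`; the
    -- others contain `X`.
    rcases Nat.lt_or_ge i k with hi | hi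
    · have h := injDist_add_finrank_inf (w a i).2 (w b i).2
      have hbot : (w a i).1 ⊓ (w b i).1 = ⊥ := by
        refine (Disjoint.mono ?_ ?_ (hdis a b hab)).eq_bot
        · exact (hf a (show (i : ℕ) + 1 ≤ k by omega)).trans_eq (hfk a)
        · exact (hf b (show (i : ℕ) + 1 ≤ k by omega)).trans_eq (hfk b)
      rw [hbot, finrank_bot] at h
      omega
    · have h := injDist_add_eq_finrank_sup (w a i).2 (w b i).2
      have htop : (w a i).1 ⊔ (w b i).1 = ⊤ := by
        rw [eq_top_iff, ← htop a b hab]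
        refine sup_le_sup ((hXQ a).trans ?_) ((hXQ b).trans ?_)
        · exact (hfk1 a).symm.trans_le (hf a (show k + 1 ≤ (i : ℕ) + 1 by omega))
        · exact (hfk1 b).symm.trans_le (hf b (show k + 1 ≤ (i : ℕ) + 1 by omega))
      rw [htop, finrank_top, hv] at h
      omega
  have hdist {a b : ι} (hab : a ≠ b) : k * m ≤ grassmannDist (w a) (w b) :=
    (sum_min_eq_mul hk hm).symm.trans_le (sum_le_sum fun i _ => hle hab i)
  -- Equal words would share their k-dimensional entry, which would be disjoint from itself although
  -- k ≥ 1.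
  have hinj : Function.Injective w := by
    intro a b hab
    by_contra hne
    have h1 := hdis a b hne
    have h2 : f a k = f b k := by
      have := congrArg Subtype.val (congrFun hab ⟨k - 1, by omega⟩)
      simpa [w, Nat.sub_add_cancel hk] using this
    rw [hfk, hfk] at h2
    rw [h2, disjoint_self] at h1
    have := hP b
    rw [h1, finrank_bot] at this
    omega
  refine ⟨univ.image w, ?_, ?_, ?_⟩
  · simp only [mem_image, mem_univ, true_and, forall_exists_index, forall_apply_eq_imp_iff]
    intro a i j hij
    refine lt_of_le_of_ne (hf a (by simpa using hij.le)) fun h => ?_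
    have h1 := (w a i).2
    have h2 := (w a j).2
    simp only at h
    rw [h] at h1
    have := h1.symm.trans h2
    have : (i : ℕ) < j := hij
    omega
  · simp only [MinDistGe, mem_image, mem_univ, true_and, forall_exists_index,
      forall_apply_eq_imp_iff]
    exact fun a b hab => hdist fun h => hab (congrArg w h)
  · rw [card_image_of_injective _ hinj, card_univ, hcard]

theorem maxFullFlagCode_le_maxCartesianCode (F : Type*) [Field F] [Finite F] (v d : ℕ) :
    maxFullFlagCode F v d ≤ maxCartesianCode F v d := by
  obtain ⟨C, -, hC, hn⟩ := (isGreatest_maxFullFlagCode F v d).1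
  exact (isGreatest_maxCartesianCode F v d).2 ⟨C, hC, hn⟩

/-- Only the upper bound needs k ≥ 2 when m = k + 1: for k = 1 all q² + q + 1 points of a
3-dimensional space form a partial spread. -/
theorem maxCartesianCode_eq [Fintype F] (hk : 1 ≤ k) (hm : m = k ∨ m = k + 1 ∧ 2 ≤ k) :
    maxCartesianCode F (k + m) (k * m) = Fintype.card F ^ m + 1 ∧
      maxCartesianCode F (k + m) (k * m) = maxFullFlagCode F (k + m) (k * m) := by
  classical
  have hm' : m = k ∨ m = k + 1 := hm.imp_right And.left
  have h1 := (isGreatest_maxFullFlagCode F (k + m) (k * m)).2 (mem_fullFlagCodeSizes hk hm')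
  have h2 := maxFullFlagCode_le_maxCartesianCode F (k + m) (k * m)
  have h3 : maxCartesianCode F (k + m) (k * m) ≤ Fintype.card F ^ m + 1 := by
    obtain ⟨C, hC, hn⟩ := (isGreatest_maxCartesianCode F (k + m) (k * m)).1
    rw [← hn]
    let i : Fin (k + m - 1) := ⟨k - 1, by omega⟩
    have hi : (i : ℕ) + 1 = k := Nat.sub_add_cancel hk
    have hdim : ∀ x ∈ C, finrank F (x i).1 = k := fun x _ => (x i).2.trans hi
    have hdis := hC.disjoint hk hm' i hi
    rcases hm with rfl | ⟨rfl, hk2⟩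
    · exact card_partialSpread_even_le C (fun x => (x i).1) hk
        (by rw [finrank_fin_fun, two_mul]) hdim hdis
    · exact card_partialSpread_odd_le C (fun x => (x i).1) hk2
        (by rw [finrank_fin_fun]; ring) hdim hdis
  omega

end FlagCode

theorem mainTheorem12 (F : Type*) [Field F] [Fintype F] (q : ℕ) (hq : Fintype.card F = q) :
    (∀ k : ℕ, 1 ≤ k →
      FlagCode.maxCartesianCode F (2 * k) (k ^ 2) = q ^ k + 1 ∧
      FlagCode.maxCartesianCode F (2 * k) (k ^ 2) =
        FlagCode.maxFullFlagCode F (2 * k) (k ^ 2)) ∧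
    (∀ k : ℕ, 2 ≤ k →
      FlagCode.maxCartesianCode F (2 * k + 1) (k ^ 2 + k) = q ^ (k + 1) + 1 ∧
      FlagCode.maxCartesianCode F (2 * k + 1) (k ^ 2 + k) =
        FlagCode.maxFullFlagCode F (2 * k + 1) (k ^ 2 + k)) := by
  subst hq
  refine ⟨fun k hk => ?_, fun k hk => ?_⟩
  · rw [two_mul, sq]
    exact FlagCode.maxCartesianCode_eq hk (.inl rfl)
  · rw [show 2 * k + 1 = k + (k + 1) by ring, show k ^ 2 + k = k * (k + 1) by ring]
    exact FlagCode.maxCartesianCode_eq (by omega) (.inr ⟨rfl, hk⟩)
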